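/- A set $A$ in a topological space $Z$ is called $\omega N$ if it is countable and nowhere dense in $Z$, and $C_2$ if it is second countable in the subspace topology. For a property $P$ of subsets, $Z$ is called $P$-bounded if every $A\subseteq Z$ with property $P$ has compact closure in $Z$; for $Y\subseteq Z$ the $P$-closure of $Y$ in $Z$ is $\mathrm{cl}^P_Z(Y)=\bigcup\{\overline{A} : A\subseteq Y,\ A \text{ has property } P\}$ (closures in $Z$), and $Y$ is $P$-closed in $Z$ if $Y=\mathrm{cl}^P_Z(Y)$. Let $\beta\mathbb{Q}\supseteq\mathbb{Q}$ be the Čech–Stone compactification of the rationals. A remote point of $\mathbb{Q}$ is a point $p\in\beta\mathbb{Q}\setminus\mathbb{Q}$ that does not lie in the closure in $\beta\mathbb{Q}$ of any nowhere dense subset of $\mathbb{Q}$. Let $X=\mathrm{cl}^{\omega N}_{\beta\mathbb{Q}}(\mathbb{Q})$, with the subspace topology from $\beta\mathbb{Q}$. Then (in ZFC) $X$ is $\omega N$-closed in $\beta\mathbb{Q}$, and $X$ is $\omega N$-bounded. Moreover, $\mathbb{Q}$ has a remote point, and no remote point of $\mathbb{Q}$ belongs to $X$. The space $X$ is not compact,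 although it contains $\mathbb{Q}$ as a dense second countable subspace. Consequently $X$ is not $C_2$-bounded. -/

import Mathlib

/-- A space `X` is `P`-bounded, for a property `P` of subspaces of `X`, if every subspace of `X`
with property `P` has compact closure in `X`. -/
def PBounded {X : Type*} [TopologicalSpace X] (P : Set X → Prop) : Prop :=
  ∀ A : Set X, P A → IsCompact (closure A)

/-- The `P`-closure of `Y` in `X`: the union of the closures in `X` of all subsets of `Y` that
have property `P`. -/
def pClosure {X : Type*} [TopologicalSpace X] (P : Set X → Prop) (Y : Set X) : Set X :=
  ⋃ A ∈ {A : Set X | A ⊆ Y ∧ P A}, closure A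

/-- `Y` is `P`-closed in `X` if it equals its `P`-closure in `X`. -/
def IsPClosed {X : Type*} [TopologicalSpace X] (P : Set X → Prop) (Y : Set X) : Prop :=
  Y = pClosure P Y

/-- The property `ωN`: countable and nowhere dense in the ambient space. -/
def OmegaN {X : Type*} [TopologicalSpace X] (A : Set X) : Prop :=
  A.Countable ∧ IsNowhereDense A

/-- The property `C₂`: second countable in the subspace topology. -/
def CTwo {X : Type*} [TopologicalSpace X] (A : Set X) : Prop :=
  SecondCountableTopology A

/-- A remote point of `X`: a point of `βX ∖ X` that is not in the closure in `βX` of any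
nowhere dense subset of `X`. -/
def IsRemotePoint (X : Type*) [TopologicalSpace X] (p : StoneCech X) : Prop :=
  p ∉ Set.range (stoneCechUnit : X → StoneCech X) ∧
    ∀ D : Set X, IsNowhereDense D → p ∉ closure (stoneCechUnit '' D)

/-- The copy of `ℚ` in its Čech–Stone compactification `βℚ`. -/
def ratInBeta : Set (StoneCech ℚ) :=
  Set.range (stoneCechUnit : ℚ → StoneCech ℚ)

/-- The `ωN`-closure of `ℚ` in `βℚ`. -/
def omegaNClosureRat : Set (StoneCech ℚ) :=
  pClosure OmegaN ratInBeta

open Set Topology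

/-! ### Nowhere dense sets and dense inducing maps. -/

section NowhereDense

variable {Z : Type*} [TopologicalSpace Z]

/-! Boundedness and closedness of `X` rest on `exists_omegaN_subset_closure`: a diagonal choice puts
a whole `ωN` subset of `X` in the closure of one `ωN` subset of `ℚ`, so its closure in `βℚ` stays in
`X`. A remote point comes from closed sets of `ℚ`, one missing each nowhere dense set, with the
finite intersection property (`exists_fip_isClosed_rat`); by compactness their closures in `βℚ`
share a point, and normality of `ℚ` makes it remote. Traces on `ℚ` of nowhere dense sets of `βℚ` are
nowhere dense, so `X` omits this point; being dense in `βℚ`, `X` is then not compact. -/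

theorem IsNowhereDense.union {s t : Set Z} (hs : IsNowhereDense s) (ht : IsNowhereDense t) :
    IsNowhereDense (s ∪ t) := by
  unfold IsNowhereDense at *
  rw [closure_union, interior_union_isClosed_of_interior_empty isClosed_closure ht, hs]

theorem IsNowhereDense.biUnion_lt {s : ℕ → Set Z} (hs : ∀ n, IsNowhereDense (s n)) (k : ℕ) :
    IsNowhereDense (⋃ n < k, s n) := by
  induction k with
  | zero => simp
  | succ k ih =>
    rw [biUnion_lt_succ]
    exact ih.union (hs k)

/-- The preimage of a nowhere dense set under a dense inducing map is nowhere dense. -/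
theorem IsDenseInducing.isNowhereDense_preimage {Y : Type*} [TopologicalSpace Y] {f : Y → Z}
    (hf : IsDenseInducing f) {s : Set Z} (hs : IsNowhereDense s) :
    IsNowhereDense (f ⁻¹' s) := by
  rw [IsNowhereDense, ← not_nonempty_iff_eq_empty]
  rintro ⟨y, hy⟩
  obtain ⟨W, hW, hWeq⟩ := hf.isOpen_iff.1 (isOpen_interior (s := closure (f ⁻¹' s)))
  have hsub : W ⊆ closure s := by
    have h₁ : W ⊆ closure (W ∩ range f) := hf.dense.open_subset_closure_inter hW
    refine h₁.trans (closure_minimal ?_ isClosed_closure)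
    rintro _ ⟨hw, x, rfl⟩
    have hx : x ∈ closure (f ⁻¹' s) := by
      apply interior_subset
      rw [← hWeq]
      exact hw
    exact closure_mono (image_preimage_subset f s)
      (image_closure_subset_closure_image hf.continuous (mem_image_of_mem f hx))
  have hfy : f y ∈ interior (closure s) := by
    refine interior_maximal hsub hW ?_
    rw [← hWeq] at hy
    exact hy
  rw [hs] at hfy
  exact hfy

theorem isNowhereDense_singleton [T1Space Z] (z : Z) [(𝓝[≠] z).NeBot] :
    IsNowhereDense ({z} : Set Z) := by
  rw [isClosed_singleton.isNowhereDense_iff]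
  exact interior_singleton z

end NowhereDense

/-! ### Idempotence of the `ωN`-closure of a countable dense set. -/

section OmegaNClosure

variable {Z : Type*} [TopologicalSpace Z]

theorem mem_pClosure {P : Set Z → Prop} {Y : Set Z} {z : Z} :
    z ∈ pClosure P Y ↔ ∃ A, A ⊆ Y ∧ P A ∧ z ∈ closure A := by
  simp [pClosure, and_assoc]

/-- A countable nowhere dense set of points, each in the closure of a countable nowhere dense
subset of a countable dense set `Q`, lies in the closure of a single such subset. -/
theorem exists_omegaN_subset_closure [RegularSpace Z] {Q A : Set Z} (hQc : Q.Countable)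
    (hQd : Dense Q) (hA : OmegaN A) (hAQ : A ⊆ pClosure OmegaN Q) :
    ∃ B ⊆ Q, OmegaN B ∧ A ⊆ closure B := by
  rcases A.eq_empty_or_nonempty with rfl | hne
  · exact ⟨∅, empty_subset _, ⟨countable_empty, isNowhereDense_empty⟩, empty_subset _⟩
  obtain ⟨a, rfl⟩ := hA.1.exists_eq_range hne
  have hQne : Q.Nonempty := hQd.nonempty_iff.2 ⟨a 0⟩
  obtain ⟨q, rfl⟩ := hQc.exists_eq_range hQne
  choose C hCQ hC haC using fun n ↦ mem_pClosure.1 (hAQ (mem_range_self n))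
  have hU : ∀ i, ∃ U : Set Z, IsOpen U ∧ (q i ∉ closure (range a) → q i ∈ U) ∧
      Disjoint (closure U) (closure (range a)) := by
    intro i
    by_cases hi : q i ∈ closure (range a)
    · exact ⟨∅, isOpen_empty, fun h ↦ (h hi).elim, by simp⟩
    · obtain ⟨V, ⟨hqV, hV⟩, hVsub⟩ :=
        (hasBasis_opens_closure (q i)).mem_iff.1 (isClosed_closure.isOpen_compl.mem_nhds hi)
      exact ⟨V, hV, fun _ ↦ hqV, subset_compl_iff_disjoint_right.1 hVsub⟩
  choose U hUo hqU hUd using hU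
  have hFc : ∀ n, IsClosed (⋃ i ≤ n, closure (U i)) := fun n ↦
    (finite_Iic n).isClosed_biUnion fun _ _ ↦ isClosed_closure
  -- Only finitely many closed sets, all missing `closure (range a)`, are cut out of `C n`, so `a n`
  -- stays in its closure; yet `U i` meets only the pieces with `n < i`.
  refine ⟨⋃ n, C n \ ⋃ i ≤ n, closure (U i), ?_, ⟨?_, ?_⟩, ?_⟩
  · exact iUnion_subset fun n ↦ sdiff_subset.trans (hCQ n)
  · exact countable_iUnion fun n ↦ (hC n).1.mono sdiff_subset
  · rw [IsNowhereDense, ← not_nonempty_iff_eq_empty]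
    intro hW
    set B := ⋃ n, C n \ ⋃ i ≤ n, closure (U i)
    -- Since `range a` is nowhere dense, it suffices to refute interior points of `closure B` off
    -- its closure, where some `q i` can be found.
    have hWA : (interior (closure B) ∩ (closure (range a))ᶜ).Nonempty := by
      rw [inter_compl_nonempty_iff]
      intro hsub
      have := interior_maximal hsub isOpen_interior
      rw [hA.2] at this
      exact hW.ne_empty (subset_empty_iff.1 this)
    obtain ⟨_, ⟨hiW, hiA⟩, i, rfl⟩ :=
      hQd.inter_open_nonempty _ (isOpen_interior.inter isClosed_closure.isOpen_compl) hWA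
    have hVo : IsOpen (interior (closure B) ∩ U i) := isOpen_interior.inter (hUo i)
    have hsub : interior (closure B) ∩ U i ⊆ closure (⋃ n < i, C n) := by
      have h₁ : interior (closure B) ∩ U i ⊆ closure ((interior (closure B) ∩ U i) ∩ B) :=
        fun z hz ↦ hVo.inter_closure ⟨hz, interior_subset hz.1⟩
      refine h₁.trans (closure_mono ?_)
      rintro z ⟨⟨-, hzU⟩, hzB⟩
      obtain ⟨n, hzC, hzn⟩ := mem_iUnion.1 hzB
      refine mem_iUnion₂.2 ⟨n, ?_, hzC⟩
      by_contra! hin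
      exact hzn (mem_iUnion₂.2 ⟨i, hin, subset_closure hzU⟩)
    have hmem := interior_maximal hsub hVo ⟨hiW, hqU i hiA⟩
    rw [IsNowhereDense.biUnion_lt (fun n ↦ (hC n).2) i] at hmem
    exact hmem
  · rintro _ ⟨n, rfl⟩
    refine closure_mono (subset_iUnion _ n) ?_
    have : a n ∈ closure (C n) ∩ (⋃ i ≤ n, closure (U i))ᶜ := by
      refine ⟨haC n, fun h ↦ ?_⟩
      obtain ⟨i, -, hi⟩ := mem_iUnion₂.1 h
      exact (hUd i).notMem_of_mem_left hi (subset_closure (mem_range_self n))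
    exact (hFc n).isOpen_compl.closure_inter this

/-- The closure of a countable nowhere dense subset of the `ωN`-closure of a countable dense set
stays inside this `ωN`-closure. -/
theorem closure_subset_pClosure_omegaN [RegularSpace Z] {Q A : Set Z} (hQc : Q.Countable)
    (hQd : Dense Q) (hA : OmegaN A) (hAQ : A ⊆ pClosure OmegaN Q) :
    closure A ⊆ pClosure OmegaN Q := by
  obtain ⟨B, hBQ, hB, hAB⟩ := exists_omegaN_subset_closure hQc hQd hA hAQ
  exact fun z hz ↦ mem_pClosure.2 ⟨B, hBQ, hB, closure_minimal hAB isClosed_closure hz⟩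

theorem subset_pClosure_omegaN {Y : Set Z} (hY : ∀ y ∈ Y, IsNowhereDense ({y} : Set Z)) :
    Y ⊆ pClosure OmegaN Y := fun y hy ↦
  mem_pClosure.2 ⟨{y}, singleton_subset_iff.2 hy, ⟨countable_singleton y, hY y hy⟩,
    subset_closure rfl⟩

theorem isPClosed_pClosure_omegaN [RegularSpace Z] {Q : Set Z} (hQc : Q.Countable)
    (hQd : Dense Q) (hQs : ∀ y ∈ Q, IsNowhereDense ({y} : Set Z)) :
    IsPClosed OmegaN (pClosure OmegaN Q) := by
  refine Subset.antisymm (fun z hz ↦ ?_) (fun z hz ↦ ?_)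
  · obtain ⟨A, hAQ, hA, hzA⟩ := mem_pClosure.1 hz
    exact mem_pClosure.2 ⟨A, hAQ.trans (subset_pClosure_omegaN hQs), hA, hzA⟩
  · obtain ⟨A, hAX, hA, hzA⟩ := mem_pClosure.1 hz
    exact closure_subset_pClosure_omegaN hQc hQd hA hAX hzA

theorem pBounded_pClosure_omegaN [RegularSpace Z] [CompactSpace Z] {Q : Set Z}
    (hQc : Q.Countable) (hQd : Dense Q) :
    PBounded (OmegaN : Set (pClosure OmegaN Q) → Prop) := by
  intro A hA
  have hcl := closure_subset_pClosure_omegaN hQc hQd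
    (A := Subtype.val '' A) ⟨hA.1.image _, hA.2.image_val⟩ (by simp)
  rw [IsInducing.subtypeVal.closure_eq_preimage_closure_image A]
  exact IsInducing.subtypeVal.isCompact_preimage' isClosed_closure.isCompact (by simpa using hcl)

end OmegaNClosure

/-! ### Existence of a remote point of `ℚ`. -/

section RemotePoint

/-- If every member of a family `D` misses some `B l` inside each `B j`, then finite sets `s i` of
indices can be chosen so that `⋃ l ∈ s i, B l` misses `D i` while any `n` of these unions contain
a common `B l`. -/
theorem exists_linked_finset {α ι : Type*} (B : ℕ → Set α) (D : ι → Set α)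
    (h : ∀ i j, ∃ l, B l ⊆ B j ∧ Disjoint (B l) (D i)) (n : ℕ) :
    ∃ s : ι → Finset ℕ, (∀ i, ∀ l ∈ s i, Disjoint (B l) (D i)) ∧
      ∀ S : Finset ι, S.card ≤ n → ∃ l, ∀ i ∈ S, ∃ m ∈ s i, B l ⊆ B m := by
  classical
  choose r hrB hrD using h
  -- `k i (t + 1)` bounds `r i j` for every `j ≤ k i t`, so `t` counts the refinements allowed for.
  let k : ι → ℕ → ℕ := fun i t ↦
    Nat.rec 0 (fun _ x ↦ max x ((Finset.range (x + 1)).sup (r i))) t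
  have hk : ∀ i t, k i (t + 1) = max (k i t) ((Finset.range (k i t + 1)).sup (r i)) :=
    fun _ _ ↦ rfl
  have hmono : ∀ i, Monotone (k i) := fun i ↦
    monotone_nat_of_le_succ fun t ↦ by rw [hk]; exact le_max_left _ _
  have hr : ∀ i t j, j ≤ k i t → r i j ≤ k i (t + 1) := fun i t j hj ↦ by
    rw [hk]
    exact (Finset.le_sup (f := r i) (by simpa [Nat.lt_succ_iff] using hj)).trans (le_max_right _ _)
  have key : ∀ (m t : ℕ) (S : Finset ι) (j : ℕ), S.card = m → (∀ i ∈ S, j ≤ k i t) →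
      ∃ l, B l ⊆ B j ∧ ∀ i ∈ S, ∃ p ≤ k i (t + m), Disjoint (B p) (D i) ∧ B l ⊆ B p := by
    intro m
    induction m with
    | zero =>
      intro t S j hS _
      obtain rfl := Finset.card_eq_zero.1 hS
      exact ⟨j, Subset.rfl, by simp⟩
    | succ m ih =>
      intro t S j hS hj
      -- Refining first for the index with the least bound keeps `r i₀ j` below the bounds of all
      -- remaining indices, so the induction continues from there.
      obtain ⟨i₀, hi₀, hmin⟩ := S.exists_min_image (fun i ↦ k i (t + 1))
        (Finset.card_pos.1 (by omega))
      have hle := hr i₀ t j (hj i₀ hi₀)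
      obtain ⟨l, hl, hlS⟩ := ih (t + 1) (S.erase i₀) (r i₀ j)
        (by rw [Finset.card_erase_of_mem hi₀]; omega)
        (fun i hi ↦ hle.trans (hmin i (Finset.mem_of_mem_erase hi)))
      refine ⟨l, hl.trans (hrB i₀ j), fun i hi ↦ ?_⟩
      rcases eq_or_ne i i₀ with rfl | hne
      · exact ⟨r i j, hle.trans (hmono i (show t + 1 ≤ t + (m + 1) by omega)), hrD i j, hl⟩
      · obtain ⟨p, hp, hpD⟩ := hlS i (Finset.mem_erase.2 ⟨hne, hi⟩)
        exact ⟨p, hp.trans (hmono i (show t + 1 + m ≤ t + (m + 1) by omega)), hpD⟩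
  refine ⟨fun i ↦ (Finset.range (k i n + 1)).filter fun l ↦ Disjoint (B l) (D i),
    fun i l hl ↦ (Finset.mem_filter.1 hl).2, fun S hS ↦ ?_⟩
  obtain ⟨l, -, hl⟩ := key S.card 0 S 0 rfl (fun _ _ ↦ Nat.zero_le _)
  refine ⟨l, fun i hi ↦ ?_⟩
  obtain ⟨p, hp, hpD, hlp⟩ := hl i hi
  refine ⟨p, Finset.mem_filter.2 ⟨?_, hpD⟩, hlp⟩
  have := hmono i (show 0 + S.card ≤ n by omega)
  exact Finset.mem_range.2 (by omega)

/-- Every nondegenerate rational interval contains another one missing a given nowhere dense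
set. -/
theorem exists_Icc_subset_disjoint_closure {D : Set ℚ} (hD : IsNowhereDense D) {a b : ℚ}
    (hab : a < b) :
    ∃ c d, c < d ∧ Icc c d ⊆ Icc a b ∧ Disjoint (Icc c d) (closure D) := by
  have hne : (Ioo a b ∩ (closure D)ᶜ).Nonempty := by
    rw [inter_compl_nonempty_iff]
    intro hsub
    obtain ⟨x, hx⟩ := nonempty_Ioo.2 hab
    have := interior_maximal hsub isOpen_Ioo hx
    rw [hD] at this
    exact this
  obtain ⟨x, hx⟩ := hne
  have hnhds : Ioo a b ∩ (closure D)ᶜ ∈ 𝓝 x :=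
    (isOpen_Ioo.inter isClosed_closure.isOpen_compl).mem_nhds hx
  obtain ⟨y, hxy, hy⟩ : ∃ y, x < y ∧ Icc x y ⊆ Ioo a b ∩ (closure D)ᶜ := by
    obtain ⟨u, hu, hsub⟩ := exists_Ico_subset_of_mem_nhds hnhds (exists_gt x)
    obtain ⟨y, hxy, hyu⟩ := exists_between hu
    exact ⟨y, hxy, fun z hz ↦ hsub ⟨hz.1, hz.2.trans_lt hyu⟩⟩
  exact ⟨x, y, hxy, fun z hz ↦ Ioo_subset_Icc_self (hy hz).1,
    disjoint_left.2 fun z hz ↦ (hy hz).2⟩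

/-- For every `n` there are closed subsets of `[n, n + 1/2]`, one missing each nowhere dense set,
any `n` of which have a common point. -/
theorem exists_linked_isClosed_rat (n : ℕ) :
    ∃ F : {D : Set ℚ // IsNowhereDense D} → Set ℚ,
      (∀ D, IsClosed (F D)) ∧ (∀ D, F D ⊆ Icc (n : ℚ) (n + 1 / 2)) ∧
      (∀ D, Disjoint (F D) (closure D.1)) ∧
      ∀ S : Finset {D : Set ℚ // IsNowhereDense D}, S.card ≤ n → (⋂ D ∈ S, F D).Nonempty := by
  let T := {p : ℚ × ℚ // p.1 < p.2 ∧ Icc p.1 p.2 ⊆ Icc (n : ℚ) (n + 1 / 2)}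
  have : Nonempty T := ⟨⟨((n : ℚ), (n : ℚ) + 1 / 2), by norm_num, Subset.rfl⟩⟩
  obtain ⟨e, he⟩ := exists_surjective_nat T
  obtain ⟨s, hsD, hs⟩ := exists_linked_finset (fun l ↦ Icc (e l).1.1 (e l).1.2)
    (fun D : {D : Set ℚ // IsNowhereDense D} ↦ closure D.1) (by
      intro D j
      obtain ⟨c, d, hcd, hsub, hdisj⟩ := exists_Icc_subset_disjoint_closure D.2 (e j).2.1
      obtain ⟨l, hl⟩ := he ⟨(c, d), hcd, hsub.trans (e j).2.2⟩
      exact ⟨l, by simpa only [hl] using hsub, by simpa only [hl] using hdisj⟩) n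
  refine ⟨fun D ↦ ⋃ l ∈ s D, Icc (e l).1.1 (e l).1.2, fun D ↦ ?_, fun D ↦ ?_, fun D ↦ ?_,
    fun S hS ↦ ?_⟩
  · exact (s D).finite_toSet.isClosed_biUnion fun _ _ ↦ isClosed_Icc
  · exact iUnion₂_subset fun l _ ↦ (e l).2.2
  · exact disjoint_iUnion₂_left.2 fun l hl ↦ hsD D l hl
  · obtain ⟨l, hl⟩ := hs S hS
    refine ⟨(e l).1.1, mem_iInter₂.2 fun D hD ↦ ?_⟩
    obtain ⟨m, hm, hlm⟩ := hl D hD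
    exact mem_iUnion₂.2 ⟨m, hm, hlm (left_mem_Icc.2 (e l).2.1.le)⟩

theorem locallyFinite_Icc_natCast_rat :
    LocallyFinite fun n : ℕ ↦ Icc (n : ℚ) (n + 1 / 2) := by
  intro x
  refine ⟨Iio (x + 1), Iio_mem_nhds (by linarith), ?_⟩
  refine (finite_Iic ⌈x + 1⌉₊).subset ?_
  rintro n ⟨y, hy, hyx⟩
  have h₁ : (n : ℚ) ≤ ⌈x + 1⌉₊ := (hy.1.trans (le_of_lt hyx)).trans (Nat.le_ceil _)
  exact_mod_cast h₁

/-- Closed sets missing the nowhere dense sets can be chosen with the finite intersection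
property. -/
theorem exists_fip_isClosed_rat :
    ∃ F : {D : Set ℚ // IsNowhereDense D} → Set ℚ,
      (∀ D, IsClosed (F D)) ∧ (∀ D, Disjoint (F D) (closure D.1)) ∧
      ∀ S : Finset {D : Set ℚ // IsNowhereDense D}, (⋂ D ∈ S, F D).Nonempty := by
  choose F hFc hFsub hFd hF using exists_linked_isClosed_rat
  -- The levels lie in a locally finite family of intervals, so their union is closed; a finite `S`
  -- is served by level `S.card`.
  refine ⟨fun D ↦ ⋃ n, F n D, fun D ↦ ?_, fun D ↦ ?_, fun S ↦ ?_⟩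
  · exact (locallyFinite_Icc_natCast_rat.subset fun n ↦ hFsub n D).isClosed_iUnion
      fun n ↦ hFc n D
  · exact disjoint_iUnion_left.2 fun n ↦ hFd n D
  · obtain ⟨x, hx⟩ := hF S.card S le_rfl
    exact ⟨x, mem_iInter₂.2 fun D hD ↦ mem_iUnion.2 ⟨S.card, mem_iInter₂.1 hx D hD⟩⟩

/-- Disjoint closed sets of a normal space have disjoint closures in its Čech–Stone
compactification. -/
theorem disjoint_closure_image_stoneCechUnit {X : Type*} [TopologicalSpace X] [NormalSpace X]
    {s t : Set X} (hs : IsClosed s) (ht : IsClosed t) (hst : Disjoint s t) :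
    Disjoint (closure (stoneCechUnit '' s)) (closure (stoneCechUnit '' t)) := by
  obtain ⟨f, hf₀, hf₁, hf⟩ := exists_continuous_zero_one_of_isClosed hs ht hst
  have hg : Continuous fun x ↦ (⟨f x, hf x⟩ : Icc (0 : ℝ) 1) := f.continuous.subtype_mk _
  have hext := continuous_stoneCechExtend hg
  have h₀ : closure (stoneCechUnit '' s) ⊆ stoneCechExtend hg ⁻¹' {⟨0, by simp⟩} := by
    refine closure_minimal ?_ (isClosed_singleton.preimage hext)
    rintro _ ⟨x, hx, rfl⟩
    simpa [Subtype.ext_iff] using hf₀ hx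
  have h₁ : closure (stoneCechUnit '' t) ⊆ stoneCechExtend hg ⁻¹' {⟨1, by simp⟩} := by
    refine closure_minimal ?_ (isClosed_singleton.preimage hext)
    rintro _ ⟨x, hx, rfl⟩
    simpa [Subtype.ext_iff] using hf₁ hx
  refine disjoint_left.2 fun p hp hq ↦ ?_
  have h := (h₀ hp).symm.trans (h₁ hq)
  simp at h

theorem exists_isRemotePoint_rat : ∃ p : StoneCech ℚ, IsRemotePoint ℚ p := by
  obtain ⟨F, hFc, hFd, hF⟩ := exists_fip_isClosed_rat
  obtain ⟨p, hp⟩ := CompactSpace.iInter_nonempty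
    (t := fun D ↦ closure ((stoneCechUnit : ℚ → StoneCech ℚ) '' F D))
    (fun _ ↦ isClosed_closure) (fun S ↦ by
      obtain ⟨x, hx⟩ := hF S
      exact ⟨stoneCechUnit x, mem_iInter₂.2 fun D hD ↦
        subset_closure (mem_image_of_mem _ (mem_iInter₂.1 hx D hD))⟩)
  have hremote : ∀ D : Set ℚ, IsNowhereDense D → p ∉ closure (stoneCechUnit '' D) := by
    intro D hD hpD
    exact (disjoint_closure_image_stoneCechUnit (hFc ⟨D, hD⟩) isClosed_closure
      (hFd ⟨D, hD⟩)).notMem_of_mem_left (mem_iInter.1 hp ⟨D, hD⟩)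
      (closure_mono (image_mono subset_closure) hpD)
  refine ⟨p, ?_, hremote⟩
  rintro ⟨x, rfl⟩
  exact hremote {x} (isNowhereDense_singleton x) (subset_closure (mem_image_of_mem _ rfl))

end RemotePoint

theorem countable_ratInBeta : ratInBeta.Countable := countable_range _

theorem dense_ratInBeta : Dense ratInBeta := denseRange_stoneCechUnit

theorem isNowhereDense_singleton_of_mem_ratInBeta {y : StoneCech ℚ} (hy : y ∈ ratInBeta) :
    IsNowhereDense ({y} : Set (StoneCech ℚ)) := by
  obtain ⟨x, rfl⟩ := hy
  simpa using isInducing_stoneCechUnit.isNowhereDense_image (isNowhereDense_singleton x)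

theorem ratInBeta_subset_omegaNClosureRat : ratInBeta ⊆ omegaNClosureRat :=
  subset_pClosure_omegaN fun _ ↦ isNowhereDense_singleton_of_mem_ratInBeta

theorem IsRemotePoint.notMem_omegaNClosureRat {p : StoneCech ℚ} (hp : IsRemotePoint ℚ p) :
    p ∉ omegaNClosureRat := by
  intro hpX
  obtain ⟨A, hAQ, hA, hpA⟩ := mem_pClosure.1 hpX
  refine hp.2 _ (isDenseInducing_stoneCechUnit.isNowhereDense_preimage hA.2) ?_
  rwa [image_preimage_eq_of_subset hAQ]

theorem not_compactSpace_omegaNClosureRat : ¬ CompactSpace omegaNClosureRat := by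
  intro h
  obtain ⟨p, hp⟩ := exists_isRemotePoint_rat
  -- A compact `X` would be closed and dense, hence all of `βℚ`, remote points included.
  have hclosed : IsClosed omegaNClosureRat := (isCompact_iff_compactSpace.2 h).isClosed
  have huniv : omegaNClosureRat = univ := by
    rw [← hclosed.closure_eq]
    exact (dense_ratInBeta.mono ratInBeta_subset_omegaNClosureRat).closure_eq
  exact hp.notMem_omegaNClosureRat (huniv ▸ mem_univ p)

theorem dense_preimage_ratInBeta :
    Dense (Subtype.val ⁻¹' ratInBeta : Set omegaNClosureRat) := by
  rw [Subtype.dense_iff, Subtype.image_preimage_coe,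
    inter_eq_right.2 ratInBeta_subset_omegaNClosureRat]
  exact fun x _ ↦ dense_ratInBeta x

theorem cTwo_preimage_ratInBeta :
    CTwo (Subtype.val ⁻¹' ratInBeta : Set omegaNClosureRat) := by
  have : SecondCountableTopology ratInBeta :=
    (isEmbedding_stoneCechUnit (X := ℚ)).toHomeomorph.symm.secondCountableTopology
  have hind : IsInducing fun x : (Subtype.val ⁻¹' ratInBeta : Set omegaNClosureRat) ↦
      (⟨x.1.1, x.2⟩ : ratInBeta) :=
    (IsInducing.subtypeVal.comp IsInducing.subtypeVal).codRestrict _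
  exact hind.secondCountableTopology

theorem mainTheorem12 :
    -- the `ωN`-closure `X` of `ℚ` is `ωN`-closed in `βℚ`, and as a space it is `ωN`-bounded
    IsPClosed OmegaN omegaNClosureRat ∧
    PBounded (OmegaN : Set omegaNClosureRat → Prop) ∧
    -- `ℚ` has a remote point, and no remote point of `ℚ` belongs to `X`
    (∃ p : StoneCech ℚ, IsRemotePoint ℚ p) ∧
    (∀ p : StoneCech ℚ, IsRemotePoint ℚ p → p ∉ omegaNClosureRat) ∧
    -- `X` is not compact
    ¬ CompactSpace omegaNClosureRat ∧
    -- `X` contains (the copy of) `ℚ`, which is a dense second countable subspace of `X`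
    ratInBeta ⊆ omegaNClosureRat ∧
    Dense (Subtype.val ⁻¹' ratInBeta : Set omegaNClosureRat) ∧
    CTwo (Subtype.val ⁻¹' ratInBeta : Set omegaNClosureRat) ∧
    -- `X` is not `C₂`-bounded
    ¬ PBounded (CTwo : Set omegaNClosureRat → Prop) := by
  refine ⟨isPClosed_pClosure_omegaN countable_ratInBeta dense_ratInBeta
      fun _ ↦ isNowhereDense_singleton_of_mem_ratInBeta,
    pBounded_pClosure_omegaN countable_ratInBeta dense_ratInBeta,
    exists_isRemotePoint_rat, fun _ hp ↦ hp.notMem_omegaNClosureRat,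
    not_compactSpace_omegaNClosureRat, ratInBeta_subset_omegaNClosureRat,
    dense_preimage_ratInBeta, cTwo_preimage_ratInBeta, fun h ↦ ?_⟩
  have hcompact := h _ cTwo_preimage_ratInBeta
  rw [dense_preimage_ratInBeta.closure_eq] at hcompact
  exact not_compactSpace_omegaNClosureRat ⟨hcompact⟩
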